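/- Let $E$ be a Euclidean space (a finite-dimensional real inner product space). For $F\subset E$ let $d_F(x)=\inf_{z\in F}\|z-x\|$ and let $P_F(x)$ be the set of points $z \in F$ minimizing $\|z-x\|$. For $\bar x\in F$, call $F$ prox-regular at $\bar x$ if $P_F(x)$ is a singleton for every $x$ in some neighborhood of $\bar x$, and let the normal cone be $$N_F(\bar x)=\Big\{\lim_n t_n(x_n-z_n) : t_n\ge 0,\ x_n\to\bar x,\ z_n\in P_F(x_n)\Big\}.$$ Sets $F_1,\dots,F_m\subset E$ ($m\ge1$) have strongly regular intersection at $\bar x\in\bigcap_i F_i$ if the only vectors $y_i\in N_{F_i}(\bar x)$ $(i=1,\dots,m)$ with $\sum_i y_i=0$ are $y_1=\dots=y_m=0$. Their condition modulus $\mathrm{cond}(F_1,\dots,F_m|\bar x)$ is the infimum of all constants $k>0$ such that $$\sqrt{\textstyle\sum_i\|y_i\|^2}\le k\,\Big\|\textstyle\sum_i y_i\Big\|\quad\text{whenever } y_i\in N_{F_i}(\bar x)\ (i=1,\dots,m).$$ **Theorem (Q-linear convergence for averaged projections).** Let $F_1,\dots,F_m\subset E$ be sets that are prox-regular at a point $\bar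 x\in\bigcap_i F_i$ and have strongly regular intersection at $\bar x$, and let $k>\mathrm{cond}(F_1,\dots,F_m|\bar x)$ be any real constant. Put $$f=\frac1{2m}\sum_{i=1}^m d_{F_i}^2 .$$ Then there is a neighborhood $U$ of $\bar x$ such that, for every $x\in U$, the averaged projection iterate $x_+=\frac1m\sum_{i=1}^m z_i$ with $z_i\in P_{F_i}(x)$ exists and is unique, and it satisfies $$f(x_+)\le\Big(1-\frac1{k^2m}\Big)f(x).$$ -/

import Mathlib

open Filter Topology

namespace AveragedProjections

variable {E : Type*} [NormedAddCommGroup E] [InnerProductSpace ℝ E]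

/-- The (multivalued) projection `P_F(x)`: the set of nearest points of `F` to `x`. -/
def proj (F : Set E) (x : E) : Set E :=
  {z | z ∈ F ∧ ∀ w ∈ F, ‖z - x‖ ≤ ‖w - x‖}

/-- The (limiting) normal cone `N_F(a)`: all limits of `t_n (x_n - z_n)` with `t_n ≥ 0`,
`x_n → a` and `z_n ∈ P_F(x_n)`. -/
def normalCone (F : Set E) (a : E) : Set E :=
  {v | ∃ (t : ℕ → ℝ) (x z : ℕ → E),
    (∀ n, 0 ≤ t n) ∧ Tendsto x atTop (𝓝 a) ∧ (∀ n, z n ∈ proj F (x n)) ∧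
      Tendsto (fun n => t n • (x n - z n)) atTop (𝓝 v)}

/-- `F` is prox-regular at `a ∈ F`: the projection onto `F` is single-valued around `a`. -/
def ProxRegularAt (F : Set E) (a : E) : Prop :=
  a ∈ F ∧ ∀ᶠ x in 𝓝 a, ∃! z, z ∈ proj F x

/-- The family `F` has strongly regular intersection at `a`: the only normals
`y_i ∈ N_{F_i}(a)` that sum to zero are all zero. -/
def StronglyRegularAt {m : ℕ} (F : Fin m → Set E) (a : E) : Prop :=
  ∀ y : Fin m → E, (∀ i, y i ∈ normalCone (F i) a) → ∑ i, y i = 0 → ∀ i, y i = 0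

/-- The condition modulus `cond(F_1, …, F_m | a)`: the infimum of all constants `k > 0` such that
`√(∑ ‖y_i‖²) ≤ k ‖∑ y_i‖` for all normals `y_i ∈ N_{F_i}(a)`. The infimum is taken in the
extended reals, so it is `+∞` when there is no such `k`. -/
noncomputable def cond {m : ℕ} (F : Fin m → Set E) (a : E) : EReal :=
  sInf ((fun k : ℝ => (k : EReal)) '' {k : ℝ | 0 < k ∧
    ∀ y : Fin m → E, (∀ i, y i ∈ normalCone (F i) a) →
      Real.sqrt (∑ i, ‖y i‖ ^ 2) ≤ k * ‖∑ i, y i‖})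

/-- `x'` is obtained from `x` by one iteration of the method of averaged projections. -/
def IsAveragedStep {m : ℕ} (F : Fin m → Set E) (x x' : E) : Prop :=
  ∃ z : Fin m → E, (∀ i, z i ∈ proj (F i) x) ∧ x' = (1 / (m : ℝ)) • ∑ i, z i

/-- The mean-squared-distance `(1 / 2m) ∑ d_{F_i}(x)²`. -/
noncomputable def meanSqDist {m : ℕ} (F : Fin m → Set E) (x : E) : ℝ :=
  (1 / (2 * (m : ℝ))) * ∑ i, Metric.infDist x (F i) ^ 2

end AveragedProjections

namespace AveragedProjections

/-! Near `a` the displacements x - z_i are almost normals, so by compactness they obey the condition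
inequality with any k above the modulus (`eventually_sqrt_sum_le_of_cond_lt`). Replacing x by the
barycenter x' of the z_i lowers ∑ ‖x - z_i‖² by exactly ‖∑ (x - z_i)‖² / m
(`sum_norm_barycenter_sub_sq`), hence by at least the fraction 1/(k² m) of it. Finally d_{F_i}(x') ≤
‖x' - z_i‖, since z_i ∈ F_i. -/

theorem infDist_eq_of_mem_proj {E : Type*} [NormedAddCommGroup E] {F : Set E} {x z : E}
    (hz : z ∈ proj F x) : Metric.infDist x F = ‖x - z‖ := by
  apply le_antisymm
  · simpa [dist_eq_norm] using Metric.infDist_le_dist_of_mem (x := x) hz.1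
  · refine (Metric.le_infDist ⟨z, hz.1⟩).2 fun w hw => ?_
    rw [dist_eq_norm, norm_sub_rev x z, norm_sub_rev x w]
    exact hz.2 w hw

/-- A constant strictly above the condition modulus bounds the displacements `x - z_i` to the
nearest points, for all `x` close to the base point. -/
theorem eventually_sqrt_sum_le_of_cond_lt {E : Type*} [NormedAddCommGroup E]
    [InnerProductSpace ℝ E] [FiniteDimensional ℝ E] {m : ℕ} {F : Fin m → Set E} {a : E} {k : ℝ}
    (hk : cond F a < (k : EReal)) :
    ∀ᶠ x in 𝓝 a, ∀ z : Fin m → E, (∀ i, z i ∈ proj (F i) x) →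
      Real.sqrt (∑ i, ‖x - z i‖ ^ 2) ≤ k * ‖∑ i, (x - z i)‖ := by
  obtain ⟨_, ⟨c, ⟨hc, hcond⟩, rfl⟩, hck⟩ := sInf_lt_iff.1 hk
  have hck : c < k := EReal.coe_lt_coe_iff.1 hck
  by_contra hcon
  obtain ⟨x, hx, hbad⟩ := exists_seq_forall_of_frequently (not_eventually.1 hcon)
  push Not at hbad
  choose z hz hlt using hbad
  -- Rescaling by `s n` makes the squared norms of the displacements sum to 1, so a subsequence
  -- converges to normals that are not all zero.
  set s : ℕ → ℝ := fun n => Real.sqrt (∑ i, ‖x n - z n i‖ ^ 2) with hs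
  have hs_pos : ∀ n, 0 < s n := fun n =>
    (mul_nonneg (hc.trans hck).le (norm_nonneg _)).trans_lt (hlt n)
  set y : ℕ → Fin m → E := fun n i => (s n)⁻¹ • (x n - z n i) with hy
  have hnorm : ∀ n i, ‖y n i‖ = (s n)⁻¹ * ‖x n - z n i‖ := fun n i => by
    rw [hy, norm_smul, Real.norm_of_nonneg (inv_nonneg.2 (hs_pos n).le)]
  have hsq : ∀ n, ∑ i, ‖y n i‖ ^ 2 = 1 := fun n => by
    have h : s n ^ 2 = ∑ i, ‖x n - z n i‖ ^ 2 :=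
      Real.sq_sqrt (Finset.sum_nonneg fun i _ => sq_nonneg _)
    simp_rw [hnorm, mul_pow, ← Finset.mul_sum, ← h, ← mul_pow,
      inv_mul_cancel₀ (hs_pos n).ne', one_pow]
  have hsum : ∀ n, k * ‖∑ i, y n i‖ ≤ 1 := fun n => by
    have h : ‖∑ i, y n i‖ = (s n)⁻¹ * ‖∑ i, (x n - z n i)‖ := by
      rw [hy, ← Finset.smul_sum, norm_smul, Real.norm_of_nonneg (inv_nonneg.2 (hs_pos n).le)]
    rw [h, mul_left_comm, inv_mul_le_iff₀ (hs_pos n), mul_one]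
    exact (hlt n).le
  have hball : ∀ n, y n ∈ Metric.closedBall (0 : Fin m → E) 1 := fun n => by
    rw [mem_closedBall_zero_iff, pi_norm_le_iff_of_nonneg zero_le_one]
    intro i
    have h : ‖y n i‖ ^ 2 ≤ 1 := hsq n ▸
      Finset.single_le_sum (f := fun i => ‖y n i‖ ^ 2) (fun j _ => sq_nonneg _) (Finset.mem_univ i)
    exact (sq_le_one_iff₀ (norm_nonneg _)).1 h
  obtain ⟨v, -, φ, hφ, hv⟩ := (isCompact_closedBall (0 : Fin m → E) 1).tendsto_subseq hball
  have hvi : ∀ i, Tendsto (fun n => y (φ n) i) atTop (𝓝 (v i)) := tendsto_pi_nhds.1 hv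
  have hv_sq : ∑ i, ‖v i‖ ^ 2 = 1 := by
    refine tendsto_nhds_unique (tendsto_finsetSum _ fun i _ => ((hvi i).norm.pow 2)) ?_
    simp_rw [hsq]
    exact tendsto_const_nhds
  have hv_sum : k * ‖∑ i, v i‖ ≤ 1 :=
    le_of_tendsto' ((tendsto_finsetSum _ fun i _ => hvi i).norm.const_mul k) fun n => hsum (φ n)
  have hv_normal : ∀ i, v i ∈ normalCone (F i) a := fun i =>
    ⟨fun n => (s (φ n))⁻¹, fun n => x (φ n), fun n => z (φ n) i,
      fun n => inv_nonneg.2 (hs_pos _).le, hx.comp hφ.tendsto_atTop, fun n => hz (φ n) i, hvi i⟩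
  have h := hcond v hv_normal
  rw [hv_sq, Real.sqrt_one] at h
  -- Here `h` reads 1 ≤ c * ‖∑ v i‖, so the sum cannot vanish; then c < k contradicts `hv_sum`.
  have hpos : 0 < ‖∑ i, v i‖ := by
    by_contra h0
    nlinarith
  nlinarith

/-- The parallel-axis identity for the barycenter of finitely many points. -/
theorem sum_norm_barycenter_sub_sq {E : Type*} [NormedAddCommGroup E] [InnerProductSpace ℝ E]
    {m : ℕ} (hm : 1 ≤ m) (x : E) (z : Fin m → E) :
    ∑ i, ‖(1 / (m : ℝ)) • ∑ j, z j - z i‖ ^ 2 =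
      ∑ i, ‖x - z i‖ ^ 2 - 1 / (m : ℝ) * ‖∑ i, (x - z i)‖ ^ 2 := by
  have hm0 : (m : ℝ) ≠ 0 := by positivity
  set w : E := ∑ i, (x - z i) with hw
  have h : ∀ i, (1 / (m : ℝ)) • ∑ j, z j - z i = (x - z i) - (1 / (m : ℝ)) • w := fun i => by
    rw [hw, Finset.sum_sub_distrib, Finset.sum_const, Finset.card_univ, Fintype.card_fin,
      ← Nat.cast_smul_eq_nsmul ℝ, smul_sub, smul_smul, one_div_mul_cancel hm0, one_smul]
    abel
  simp_rw [h, fun i => norm_sub_sq_real (x - z i) ((1 / (m : ℝ)) • w), Finset.sum_add_distrib,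
    Finset.sum_sub_distrib (f := fun i => ‖x - z i‖ ^ 2), ← Finset.mul_sum,
    ← sum_inner, ← hw, inner_smul_right, real_inner_self_eq_norm_sq, norm_smul, mul_pow,
    Finset.sum_const, Finset.card_univ, Fintype.card_fin, nsmul_eq_mul, Real.norm_eq_abs, sq_abs]
  field_simp
  ring

end AveragedProjections

theorem mainTheorem4 {E : Type*} [NormedAddCommGroup E] [InnerProductSpace ℝ E]
    [FiniteDimensional ℝ E] (m : ℕ) (hm : 1 ≤ m) (F : Fin m → Set E) (a : E)
    (hprox : ∀ i, AveragedProjections.ProxRegularAt (F i) a)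
    (hreg : AveragedProjections.StronglyRegularAt F a)
    (k : ℝ) (hk : AveragedProjections.cond F a < (k : EReal)) :
    ∀ᶠ x in 𝓝 a,
      (∃! x' : E, AveragedProjections.IsAveragedStep F x x') ∧
      ∀ x' : E, AveragedProjections.IsAveragedStep F x x' →
        AveragedProjections.meanSqDist F x' ≤
          (1 - 1 / (k ^ 2 * (m : ℝ))) * AveragedProjections.meanSqDist F x := by
  have hm0 : (0 : ℝ) < m := by exact_mod_cast hm
  filter_upwards [eventually_all.2 fun i => (hprox i).2,
    AveragedProjections.eventually_sqrt_sum_le_of_cond_lt hk] with x hproj hcond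
  choose z hz hz_unique using hproj
  refine ⟨⟨_, ⟨z, hz, rfl⟩, ?_⟩, ?_⟩
  · rintro _ ⟨z', hz', rfl⟩
    rw [show z' = z from funext fun i => hz_unique i _ (hz' i)]
  rintro _ ⟨z', hz', rfl⟩
  have hk_le := hcond z' hz'
  have hsq : ∑ i, ‖x - z' i‖ ^ 2 ≤ k ^ 2 * ‖∑ i, (x - z' i)‖ ^ 2 := by
    rw [← mul_pow]
    exact (Real.sqrt_le_left ((Real.sqrt_nonneg _).trans hk_le)).1 hk_le
  have hdiv : 1 / k ^ 2 * ∑ i, ‖x - z' i‖ ^ 2 ≤ ‖∑ i, (x - z' i)‖ ^ 2 := by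
    rw [one_div]
    -- Positivity of k is not needed: at k = 0 the convention 0⁻¹ = 0 makes the left side zero.
    exact inv_mul_le_of_le_mul₀ (sq_nonneg _) (sq_nonneg _) hsq
  have hx : AveragedProjections.meanSqDist F x = 1 / (2 * (m : ℝ)) * ∑ i, ‖x - z' i‖ ^ 2 := by
    simp_rw [AveragedProjections.meanSqDist,
      AveragedProjections.infDist_eq_of_mem_proj (hz' _)]
  rw [hx]
  calc AveragedProjections.meanSqDist F ((1 / (m : ℝ)) • ∑ i, z' i)
      ≤ 1 / (2 * (m : ℝ)) * ∑ i, ‖(1 / (m : ℝ)) • ∑ j, z' j - z' i‖ ^ 2 := by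
        unfold AveragedProjections.meanSqDist
        gcongr with i
        · exact Metric.infDist_nonneg
        · rw [← dist_eq_norm]
          exact Metric.infDist_le_dist_of_mem (hz' i).1
    _ = 1 / (2 * (m : ℝ)) *
        (∑ i, ‖x - z' i‖ ^ 2 - 1 / (m : ℝ) * ‖∑ i, (x - z' i)‖ ^ 2) := by
        rw [AveragedProjections.sum_norm_barycenter_sub_sq hm x]
    _ ≤ 1 / (2 * (m : ℝ)) *
        (∑ i, ‖x - z' i‖ ^ 2 - 1 / (m : ℝ) * (1 / k ^ 2 * ∑ i, ‖x - z' i‖ ^ 2)) := by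
        gcongr
    _ = (1 - 1 / (k ^ 2 * (m : ℝ))) * (1 / (2 * (m : ℝ)) * ∑ i, ‖x - z' i‖ ^ 2) := by
        ring
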